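/- Work either in the category $\mathbf{Top}$ of topological spaces and continuous maps, with $\simeq$ denoting homotopy of maps, or in the category $\mathbf{Top^w}$ of well-pointed spaces (the inclusion of the base point is a closed cofibration) and continuous base point preserving maps, with $\simeq$ denoting homotopy relative to the base point. For maps $f\colon X\to Y$ and $\iota\colon A\to Y$, let $\mathrm{liftcat}^{\mathrm{op}}_f(\iota)\in\mathbb{N}\cup\{\infty\}$ be the least integer $n\ge 0$ for which there exist an open cover $(U_i)_{0\le i\le n}$ of $X$ and maps $l_i\colon U_i\to A$ such that $\iota\circ l_i\simeq f|_{U_i}$ for all $i$, and $\infty$ if there is no such $n$; in $\mathbf{Top^w}$ each $U_i$ is required to contain the base point of $X$, and the maps $l_i$ and the homotopies are pointed. Put $\mathrm{secat}^{\mathrm{op}}(\iota)=\mathrm{liftcat}^{\mathrm{op}}_{\mathrm{id}_Y}(\iota)$. A square given by maps $q\colon P\to X$, $p\colon P\to A$, $f\colon X\to Y$, $\iota\colon A\to Y$ is a homotopy pullback if there is a homotopy $H$ from $f\circ q$ to $\iota\circ p$ for which the map $z\mapsto (q(z),H(z,-),p(z))$ from $P$ to the space of triples $(x,\gamma,a)$,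 where $x\in X$, $a\in A$ and $\gamma$ is a path in $Y$ from $f(x)$ to $\iota(a)$, is a homotopy equivalence (everything being pointed in $\mathbf{Top^w}$). Then, in each of the two categories, $\mathrm{secat}^{\mathrm{op}}$ satisfies the following axioms. - **S0.** For every map $\iota\colon A\to Y$, $\mathrm{secat}^{\mathrm{op}}(\iota)=0$ if and only if there is a map $s\colon Y\to A$ with $\iota\circ s\simeq\mathrm{id}_Y$. - **S1.** If $\zeta\colon B\to A$, $\kappa\colon B\to X$ and $\iota\colon A\to X$ are maps with $\kappa\simeq\iota\circ\zeta$, then $\mathrm{secat}^{\mathrm{op}}(\iota)\le\mathrm{secat}^{\mathrm{op}}(\kappa)$. - **S2.** If $q\colon P\to X$, $p\colon P\to A$, $f\colon X\to Y$, $\iota\colon A\to Y$ form a homotopy pullback, then $\mathrm{secat}^{\mathrm{op}}(q)\le\mathrm{secat}^{\mathrm{op}}(\iota)$. Moreover, for every homotopy pullback as in S2, $\mathrm{liftcat}^{\mathrm{op}}_f(\iota)=\mathrm{secat}^{\mathrm{op}}(q)$. -/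

import Mathlib

open scoped unitInterval

universe u v w

noncomputable section

namespace SecatOp

/-! ### Free (unpointed) maps -/

section Free

variable {X : Type u} {Y : Type v} {A : Type w}
  [TopologicalSpace X] [TopologicalSpace Y] [TopologicalSpace A]

/-- `X` has an open cover `U 0, …, U n` such that over each `U i` the map `f` lifts through `ι` up
to homotopy. -/
def HasCategoricalCover (f : C(X, Y)) (ι : C(A, Y)) (n : ℕ) : Prop :=
  ∃ U : Fin (n + 1) → Set X, (∀ i, IsOpen (U i)) ∧ (⋃ i, U i) = Set.univ ∧
    ∀ i, ∃ l : C(U i, A), (ι.comp l).Homotopic (f.restrict (U i))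

/-- The lifting category from `f` to `ι` by open covers: the least `n` for which there is a
categorical cover by `n + 1` open sets, and `⊤` if there is none. -/
def liftcatOp (f : C(X, Y)) (ι : C(A, Y)) : ℕ∞ :=
  ⨅ (n : ℕ) (_ : HasCategoricalCover f ι n), (n : ℕ∞)

/-- The sectional category by open covers. -/
def secatOp (ι : C(A, Y)) : ℕ∞ := liftcatOp (ContinuousMap.id Y) ι

/-- The double mapping path space (standard homotopy pullback): triples `(x, γ, a)` where `γ` is a
path in `Y` from `f x` to `ι a`, with the compact-open topology on paths. -/
abbrev DoublePathSpace (f : C(X, Y)) (ι : C(A, Y)) : Type (max u v w) :=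
  {e : X × C(I, Y) × A // e.2.1 0 = f e.1 ∧ e.2.1 1 = ι e.2.2}

/-- The map `z ↦ (q z, t ↦ H (t, z), p z)` to the double mapping path space determined by a square
that commutes up to the homotopy `H`. -/
def comparisonMap {P : Type*} [TopologicalSpace P] {q : C(P, X)} {p : C(P, A)} {f : C(X, Y)}
    {ι : C(A, Y)} (H : (f.comp q).Homotopy (ι.comp p)) : C(P, DoublePathSpace f ι) where
  toFun z := ⟨(q z, (H.toContinuousMap.comp ContinuousMap.prodSwap).curry z, p z), by
    constructor <;> simp⟩
  continuous_toFun := by fun_prop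

/-- `h` is a homotopy equivalence. -/
def IsHomotopyEquiv (h : C(X, Y)) : Prop :=
  ∃ k : C(Y, X), (k.comp h).Homotopic (ContinuousMap.id X) ∧
    (h.comp k).Homotopic (ContinuousMap.id Y)

/-- The square with `q : P → X`, `p : P → A`, `f : X → Y`, `ι : A → Y` is a homotopy pullback:
it commutes up to a homotopy for which the induced map from `P` to the standard homotopy pullback
is a homotopy equivalence. -/
def IsHomotopyPullback {P : Type*} [TopologicalSpace P] (q : C(P, X)) (p : C(P, A)) (f : C(X, Y))
    (ι : C(A, Y)) : Prop :=
  ∃ H : (f.comp q).Homotopy (ι.comp p), IsHomotopyEquiv (comparisonMap H)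

end Free

/-- The axioms S0, S1, S2 of a sectional category on topological spaces and continuous maps. -/
structure IsSectionalCategory
    (secat : ∀ {A Y : Type u} [TopologicalSpace A] [TopologicalSpace Y], C(A, Y) → ℕ∞) :
    Prop where
  s0 : ∀ {A Y : Type u} [TopologicalSpace A] [TopologicalSpace Y] (ι : C(A, Y)),
    secat ι = 0 ↔ ∃ s : C(Y, A), (ι.comp s).Homotopic (ContinuousMap.id Y)
  s1 : ∀ {A B X : Type u} [TopologicalSpace A] [TopologicalSpace B] [TopologicalSpace X]
    (ζ : C(B, A)) (κ : C(B, X)) (ι : C(A, X)),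
    κ.Homotopic (ι.comp ζ) → secat ι ≤ secat κ
  s2 : ∀ {P A X Y : Type u} [TopologicalSpace P] [TopologicalSpace A] [TopologicalSpace X]
    [TopologicalSpace Y] (q : C(P, X)) (p : C(P, A)) (f : C(X, Y)) (ι : C(A, Y)),
    IsHomotopyPullback q p f ι → secat q ≤ secat ι

/-! ### Well-pointed spaces and pointed maps -/

/-- A well-pointed space: the inclusion of the base point is a closed cofibration, that is, the
base point is closed and its inclusion has the homotopy extension property. -/
structure WellPointedSpace where
  carrier : Type u
  [top : TopologicalSpace carrier]
  pt : carrier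
  isClosed_pt : IsClosed ({pt} : Set carrier)
  extend_homotopy : ∀ (Z : Type u) [TopologicalSpace Z] (g : C(carrier, Z)) (γ : C(I, Z)),
    γ 0 = g pt → ∃ G : C(I × carrier, Z), (∀ x, G (0, x) = g x) ∧ ∀ t, G (t, pt) = γ t

instance : CoeSort WellPointedSpace.{u} (Type u) := ⟨WellPointedSpace.carrier⟩

instance (X : WellPointedSpace.{u}) : TopologicalSpace X := X.top

/-- A continuous map that preserves base points. -/
structure PointedMap (X Y : WellPointedSpace.{u}) where
  map : C(X, Y)
  map_pt : map X.pt = Y.pt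

namespace PointedMap

variable {X Y Z : WellPointedSpace.{u}}

/-- The identity pointed map. -/
def id (X : WellPointedSpace.{u}) : PointedMap X X := ⟨ContinuousMap.id X, rfl⟩

/-- The composite of pointed maps. -/
def comp (g : PointedMap Y Z) (f : PointedMap X Y) : PointedMap X Z :=
  ⟨g.map.comp f.map, by simp [f.map_pt, g.map_pt]⟩

/-- Pointed homotopy: homotopy relative to the base point. -/
def Homotopic (f g : PointedMap X Y) : Prop := f.map.HomotopicRel g.map {X.pt}

end PointedMap

section Pointed

variable {X Y A P : WellPointedSpace.{u}}

/-- `X` has an open cover `U 0, …, U n` by sets that contain the base point, such that over each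
`U i` the map `f` lifts through `ι` by a pointed map, up to pointed homotopy. -/
def HasPointedCategoricalCover (f : PointedMap X Y) (ι : PointedMap A Y) (n : ℕ) : Prop :=
  ∃ U : Fin (n + 1) → Set X, (∀ i, IsOpen (U i)) ∧ (⋃ i, U i) = Set.univ ∧
    ∀ i, ∃ (hi : X.pt ∈ U i) (l : C(U i, A)), l ⟨X.pt, hi⟩ = A.pt ∧
      (ι.map.comp l).HomotopicRel (f.map.restrict (U i)) {⟨X.pt, hi⟩}

/-- The pointed lifting category by open covers. -/
def pointedLiftcatOp (f : PointedMap X Y) (ι : PointedMap A Y) : ℕ∞ :=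
  ⨅ (n : ℕ) (_ : HasPointedCategoricalCover f ι n), (n : ℕ∞)

/-- The pointed sectional category by open covers. -/
def pointedSecatOp (ι : PointedMap A Y) : ℕ∞ := pointedLiftcatOp (PointedMap.id Y) ι

/-- The base point of the double mapping path space of pointed maps: its path is constant. -/
def doublePathPt (f : PointedMap X Y) (ι : PointedMap A Y) : DoublePathSpace f.map ι.map :=
  ⟨(X.pt, ContinuousMap.const I Y.pt, A.pt), by simp [f.map_pt, ι.map_pt]⟩

/-- `h` is a pointed homotopy equivalence from `(S, s)` to `(T, t)`. -/
def IsPointedHomotopyEquiv {S T : Type*} [TopologicalSpace S] [TopologicalSpace T] (s : S) (t : T)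
    (h : C(S, T)) : Prop :=
  h s = t ∧ ∃ k : C(T, S), k t = s ∧ (k.comp h).HomotopicRel (ContinuousMap.id S) {s} ∧
    (h.comp k).HomotopicRel (ContinuousMap.id T) {t}

/-- A square of well-pointed spaces is a homotopy pullback: it commutes up to a pointed homotopy
for which the induced map from `P` to the standard homotopy pullback is a pointed homotopy
equivalence. -/
def IsPointedHomotopyPullback (q : PointedMap P X) (p : PointedMap P A) (f : PointedMap X Y)
    (ι : PointedMap A Y) : Prop :=
  ∃ H : (f.map.comp q.map).HomotopyRel (ι.map.comp p.map) {P.pt},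
    IsPointedHomotopyEquiv P.pt (doublePathPt f ι) (comparisonMap H.toHomotopy)

end Pointed

/-- The axioms S0, S1, S2 of a sectional category on well-pointed spaces and pointed maps. -/
structure IsPointedSectionalCategory
    (secat : ∀ {A Y : WellPointedSpace.{u}}, PointedMap A Y → ℕ∞) : Prop where
  s0 : ∀ {A Y : WellPointedSpace.{u}} (ι : PointedMap A Y),
    secat ι = 0 ↔ ∃ s : PointedMap Y A, (ι.comp s).Homotopic (PointedMap.id Y)
  s1 : ∀ {A B X : WellPointedSpace.{u}} (ζ : PointedMap B A) (κ : PointedMap B X)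
    (ι : PointedMap A X), κ.Homotopic (ι.comp ζ) → secat ι ≤ secat κ
  s2 : ∀ {P A X Y : WellPointedSpace.{u}} (q : PointedMap P X) (p : PointedMap P A)
    (f : PointedMap X Y) (ι : PointedMap A Y),
    IsPointedHomotopyPullback q p f ι → secat q ≤ secat ι

end SecatOp

end

universe u₁ u₂ u₃ u₄ u₅

namespace SecatOp

/-! A map `l` with a homotopy from `f ∘ j` to `ι ∘ l` is the same as a map into the double mapping
path space whose first projection is `j`. Composing it with a homotopy inverse of the comparison map
turns it into a lift of `j` through `q` up to homotopy; conversely, a lift through `q` composed with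
`p` lifts `f ∘ j` through `ι`. This is `exists_lift_iff`. For `j` the inclusion of an open set, it
shows that the same covers serve `(f, ι)` and `(id, q)`, hence the equality of invariants. S2
follows by pulling covers of `Y` back along `f`, S1 by composing lifts with `ζ`, and S0 because a
cover by one set is the whole space. The pointed case runs alike, with homotopies stationary at the
base point. -/

theorem iInf_natCast_eq_zero_iff {p : ℕ → Prop} :
    (⨅ (n : ℕ) (_ : p n), (n : ℕ∞)) = 0 ↔ p 0 := by
  refine ⟨fun h ↦ ?_, fun h ↦ le_antisymm (iInf₂_le 0 h) zero_le⟩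
  by_contra h0
  have h1 : (1 : ℕ∞) ≤ ⨅ (n : ℕ) (_ : p n), (n : ℕ∞) := by
    refine le_iInf₂ fun n hn ↦ ?_
    have : 1 ≤ n := Nat.one_le_iff_ne_zero.2 fun h ↦ h0 (h ▸ hn)
    exact_mod_cast this
  rw [h] at h1
  exact absurd h1 (by simp)

/-- If no `n` satisfies `p`, the right side is `⊤`, so infinite values need no separate case. -/
theorem iInf_natCast_mono {p r : ℕ → Prop} (h : ∀ n, p n → r n) :
    (⨅ (n : ℕ) (_ : r n), (n : ℕ∞)) ≤ ⨅ (n : ℕ) (_ : p n), (n : ℕ∞) :=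
  iInf_mono fun n ↦ iInf_const_mono (h n)

/-! ### Covers and lifts in the unpointed category. -/

section Free

variable {X : Type u₁} {Y : Type u₂} {A : Type u₃} {P : Type u₄} {W : Type u₅}
  [TopologicalSpace X] [TopologicalSpace Y] [TopologicalSpace A] [TopologicalSpace P]
  [TopologicalSpace W]

/-- The inclusion of a subset as a continuous map. -/
def inclusion (U : Set X) : C(U, X) := (ContinuousMap.id X).restrict U

/-- The first projection of the double mapping path space. -/
def DoublePathSpace.fst (f : C(X, Y)) (ι : C(A, Y)) : C(DoublePathSpace f ι, X) where
  toFun e := e.1.1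

/-- In a homotopy pullback, lifts of `j` through `q` up to homotopy correspond to lifts of `f ∘ j`
through `ι` up to homotopy. -/
theorem IsHomotopyPullback.exists_lift_iff {q : C(P, X)} {p : C(P, A)} {f : C(X, Y)} {ι : C(A, Y)}
    (h : IsHomotopyPullback q p f ι) (j : C(W, X)) :
    (∃ l : C(W, A), (ι.comp l).Homotopic (f.comp j)) ↔
      ∃ s : C(W, P), (q.comp s).Homotopic j := by
  -- Only a right homotopy inverse `k` of the comparison map is needed.
  obtain ⟨H, k, -, hk⟩ := h
  constructor
  · rintro ⟨l, ⟨G⟩⟩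
    -- Paths run from `f` to `ι`, so `G` is reversed. By definition the first projection takes
    -- `comparisonMap H` to `q` and `comparisonMap G.symm` to `j`, so projecting `hk` gives the
    -- homotopy.
    exact ⟨k.comp (comparisonMap G.symm),
      ((ContinuousMap.Homotopic.refl (DoublePathSpace.fst f ι)).comp hk).comp
        (.refl (comparisonMap G.symm))⟩
  · rintro ⟨s, hs⟩
    have hH : (f.comp q).Homotopic (ι.comp p) := ⟨H⟩
    exact ⟨p.comp s, (hH.symm.comp (.refl s)).trans ((ContinuousMap.Homotopic.refl f).comp hs)⟩

theorem hasCategoricalCover_zero_iff {f : C(X, Y)} {ι : C(A, Y)} :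
    HasCategoricalCover f ι 0 ↔ ∃ s : C(X, A), (ι.comp s).Homotopic f := by
  constructor
  · rintro ⟨U, -, hc, hl⟩
    obtain ⟨l, hl⟩ := hl 0
    have hU (x : X) : x ∈ U 0 := by
      have hx := Set.mem_univ x
      rw [← hc] at hx
      obtain ⟨i, hi⟩ := Set.mem_iUnion.1 hx
      rwa [Fin.fin_one_eq_zero i] at hi
    let e : C(X, U 0) := ⟨fun x ↦ ⟨x, hU x⟩, by fun_prop⟩
    exact ⟨l.comp e, hl.comp (.refl e)⟩
  · rintro ⟨s, hs⟩
    exact ⟨fun _ ↦ Set.univ, fun _ ↦ isOpen_univ, Set.iUnion_const _,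
      fun _ ↦ ⟨s.restrict _, hs.comp (.refl (inclusion Set.univ))⟩⟩

theorem HasCategoricalCover.postcomp {B : Type*} [TopologicalSpace B] {f : C(X, Y)} {κ : C(B, Y)}
    {ι : C(A, Y)} {ζ : C(B, A)} (h : κ.Homotopic (ι.comp ζ)) {n : ℕ}
    (hκ : HasCategoricalCover f κ n) : HasCategoricalCover f ι n := by
  obtain ⟨U, ho, hc, hl⟩ := hκ
  refine ⟨U, ho, hc, fun i ↦ ?_⟩
  obtain ⟨l, hl⟩ := hl i
  exact ⟨ζ.comp l, (h.symm.comp (.refl l)).trans hl⟩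

/-- With `g` the identity this bounds the lifting category of `f` by the sectional category of `ι`,
as S2 requires. -/
theorem HasCategoricalCover.precomp {ι : C(A, Y)} {n : ℕ} {g : C(X, Y)}
    (h : HasCategoricalCover g ι n) (f : C(W, X)) : HasCategoricalCover (g.comp f) ι n := by
  obtain ⟨U, ho, hc, hl⟩ := h
  refine ⟨fun i ↦ f ⁻¹' U i, fun i ↦ (ho i).preimage f.continuous,
    by rw [← Set.preimage_iUnion, hc, Set.preimage_univ], fun i ↦ ?_⟩
  obtain ⟨l, hl⟩ := hl i
  let e : C(f ⁻¹' U i, U i) := f.restrictPreimage (U i)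
  exact ⟨l.comp e, hl.comp (.refl e)⟩

theorem IsHomotopyPullback.hasCategoricalCover_iff {q : C(P, X)} {p : C(P, A)} {f : C(X, Y)}
    {ι : C(A, Y)} (h : IsHomotopyPullback q p f ι) (n : ℕ) :
    HasCategoricalCover f ι n ↔ HasCategoricalCover (ContinuousMap.id X) q n := by
  refine exists_congr fun U ↦ and_congr_right fun _ ↦ and_congr_right fun _ ↦
    forall_congr' fun i ↦ ?_
  -- Restriction to `U i` is, by definition, composition with the inclusion.
  exact h.exists_lift_iff (inclusion (U i))

theorem IsHomotopyPullback.liftcatOp_eq_secatOp {q : C(P, X)} {p : C(P, A)} {f : C(X, Y)}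
    {ι : C(A, Y)} (h : IsHomotopyPullback q p f ι) : liftcatOp f ι = secatOp q := by
  simp only [secatOp, liftcatOp, h.hasCategoricalCover_iff]

end Free

theorem isSectionalCategory_secatOp : IsSectionalCategory.{u} secatOp where
  s0 _ := iInf_natCast_eq_zero_iff.trans hasCategoricalCover_zero_iff
  s1 _ _ _ h := iInf_natCast_mono fun _ hn ↦ hn.postcomp h
  s2 _ _ f _ h := h.liftcatOp_eq_secatOp.symm.le.trans
    (iInf_natCast_mono fun _ hn ↦ hn.precomp f)

/-! ### Precomposition of relative homotopies. -/

section Rel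

variable {X : Type u₁} {Y : Type u₂} {Z : Type u₃} [TopologicalSpace X] [TopologicalSpace Y]
  [TopologicalSpace Z]

theorem homotopicRel_precomp {g₀ g₁ : C(Y, Z)} {T : Set Y} (h : g₀.HomotopicRel g₁ T)
    (f : C(X, Y)) {S : Set X} (hf : Set.MapsTo f S T) :
    (g₀.comp f).HomotopicRel (g₁.comp f) S :=
  h.map fun G ↦ ⟨G.toHomotopy.compContinuousMap f, fun t _ hx ↦ G.prop t _ (hf hx)⟩

theorem homotopicRel_precomp_singleton {g₀ g₁ : C(Y, Z)} {x : X} {y : Y}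
    (h : g₀.HomotopicRel g₁ {y}) (f : C(X, Y)) (hf : f x = y) :
    (g₀.comp f).HomotopicRel (g₁.comp f) {x} :=
  homotopicRel_precomp h f (Set.mapsTo_singleton.2 hf)

end Rel

/-! ### Covers and lifts in the pointed category. -/

section Pointed

variable {X Y A B P : WellPointedSpace.{u}} {W : Type u₅} [TopologicalSpace W]

/-- In a pointed homotopy pullback, pointed lifts of `j` through `q` up to pointed homotopy
correspond to pointed lifts of `f ∘ j` through `ι` up to pointed homotopy. -/
theorem IsPointedHomotopyPullback.exists_lift_iff {q : PointedMap P X} {p : PointedMap P A}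
    {f : PointedMap X Y} {ι : PointedMap A Y} (h : IsPointedHomotopyPullback q p f ι)
    (j : C(W, X)) (w : W) (hj : j w = X.pt) :
    (∃ l : C(W, A), l w = A.pt ∧ (ι.map.comp l).HomotopicRel (f.map.comp j) {w}) ↔
      ∃ s : C(W, P), s w = P.pt ∧ (q.map.comp s).HomotopicRel j {w} := by
  obtain ⟨H, -, k, hkpt, -, hk⟩ := h
  constructor
  · rintro ⟨l, hl, ⟨G⟩⟩
    -- The homotopy is stationary at `w`, so the path over `w` is constant at the base point of `Y`;
    -- hence the map into the path space is pointed.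
    have hφ : comparisonMap G.symm.toHomotopy w = doublePathPt f ι := by
      refine Subtype.ext (Prod.ext hj (Prod.ext (ContinuousMap.ext fun t ↦ ?_) hl))
      have ht := G.symm.eq_fst t (Set.mem_singleton w)
      simp only [ContinuousMap.comp_apply, hj, f.map_pt] at ht
      exact ht
    refine ⟨k.comp (comparisonMap G.symm.toHomotopy), (congrArg k hφ).trans hkpt, ?_⟩
    exact homotopicRel_precomp_singleton
      (hk.comp_continuousMap (DoublePathSpace.fst f.map ι.map)) _ hφ
  · rintro ⟨s, hspt, hs⟩
    have hH : (f.map.comp q.map).HomotopicRel (ι.map.comp p.map) {P.pt} := ⟨H⟩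
    exact ⟨p.map.comp s, (congrArg p.map hspt).trans p.map_pt,
      (homotopicRel_precomp_singleton hH.symm s hspt).trans (hs.comp_continuousMap f.map)⟩

theorem hasPointedCategoricalCover_zero_iff {f : PointedMap X Y} {ι : PointedMap A Y} :
    HasPointedCategoricalCover f ι 0 ↔ ∃ s : PointedMap X A, (ι.comp s).Homotopic f := by
  constructor
  · rintro ⟨U, -, hc, hl⟩
    obtain ⟨hi, l, hlpt, hl⟩ := hl 0
    have hU (x : X) : x ∈ U 0 := by
      have hx := Set.mem_univ x
      rw [← hc] at hx
      obtain ⟨i, hi⟩ := Set.mem_iUnion.1 hx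
      rwa [Fin.fin_one_eq_zero i] at hi
    let e : C(X, U 0) := ⟨fun x ↦ ⟨x, hU x⟩, by fun_prop⟩
    exact ⟨⟨l.comp e, hlpt⟩, homotopicRel_precomp_singleton hl e rfl⟩
  · rintro ⟨s, hs⟩
    exact ⟨fun _ ↦ Set.univ, fun _ ↦ isOpen_univ, Set.iUnion_const _,
      fun _ ↦ ⟨Set.mem_univ _, s.map.restrict _, s.map_pt,
        homotopicRel_precomp_singleton hs (inclusion Set.univ) rfl⟩⟩

theorem HasPointedCategoricalCover.postcomp {f : PointedMap X Y} {κ : PointedMap B Y}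
    {ι : PointedMap A Y} {ζ : PointedMap B A} (h : κ.Homotopic (ι.comp ζ)) {n : ℕ}
    (hκ : HasPointedCategoricalCover f κ n) : HasPointedCategoricalCover f ι n := by
  obtain ⟨U, ho, hc, hl⟩ := hκ
  refine ⟨U, ho, hc, fun i ↦ ?_⟩
  obtain ⟨hi, l, hlpt, hl⟩ := hl i
  exact ⟨hi, ζ.map.comp l, (congrArg ζ.map hlpt).trans ζ.map_pt,
    (homotopicRel_precomp_singleton h.symm l hlpt).trans hl⟩

theorem HasPointedCategoricalCover.precomp {ι : PointedMap A Y} {n : ℕ} {g : PointedMap X Y}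
    (h : HasPointedCategoricalCover g ι n) (f : PointedMap B X) :
    HasPointedCategoricalCover (g.comp f) ι n := by
  obtain ⟨U, ho, hc, hl⟩ := h
  refine ⟨fun i ↦ f.map ⁻¹' U i, fun i ↦ (ho i).preimage f.map.continuous,
    by rw [← Set.preimage_iUnion, hc, Set.preimage_univ], fun i ↦ ?_⟩
  obtain ⟨hi, l, hlpt, hl⟩ := hl i
  have hpt : B.pt ∈ f.map ⁻¹' U i := by rwa [Set.mem_preimage, f.map_pt]
  let e : C(f.map ⁻¹' U i, U i) := f.map.restrictPreimage (U i)
  have he : e ⟨B.pt, hpt⟩ = ⟨X.pt, hi⟩ := Subtype.ext f.map_pt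
  exact ⟨hpt, l.comp e, (congrArg l he).trans hlpt, homotopicRel_precomp_singleton hl e he⟩

theorem IsPointedHomotopyPullback.hasPointedCategoricalCover_iff {q : PointedMap P X}
    {p : PointedMap P A} {f : PointedMap X Y} {ι : PointedMap A Y}
    (h : IsPointedHomotopyPullback q p f ι) (n : ℕ) :
    HasPointedCategoricalCover f ι n ↔ HasPointedCategoricalCover (PointedMap.id X) q n := by
  refine exists_congr fun U ↦ and_congr_right fun _ ↦ and_congr_right fun _ ↦
    forall_congr' fun i ↦ exists_congr fun hi ↦ ?_
  exact h.exists_lift_iff (inclusion (U i)) ⟨X.pt, hi⟩ rfl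

theorem IsPointedHomotopyPullback.pointedLiftcatOp_eq_pointedSecatOp {q : PointedMap P X}
    {p : PointedMap P A} {f : PointedMap X Y} {ι : PointedMap A Y}
    (h : IsPointedHomotopyPullback q p f ι) : pointedLiftcatOp f ι = pointedSecatOp q := by
  simp only [pointedSecatOp, pointedLiftcatOp, h.hasPointedCategoricalCover_iff]

end Pointed

theorem isPointedSectionalCategory_pointedSecatOp :
    IsPointedSectionalCategory.{u} pointedSecatOp where
  s0 _ := iInf_natCast_eq_zero_iff.trans hasPointedCategoricalCover_zero_iff
  s1 _ _ _ h := iInf_natCast_mono fun _ hn ↦ hn.postcomp h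
  s2 _ _ f _ h := h.pointedLiftcatOp_eq_pointedSecatOp.symm.le.trans
    (iInf_natCast_mono fun _ hn ↦ hn.precomp f)

end SecatOp

theorem mainTheorem4 :
    SecatOp.IsSectionalCategory.{u} SecatOp.secatOp ∧
    (∀ {P A X Y : Type u} [TopologicalSpace P] [TopologicalSpace A] [TopologicalSpace X]
      [TopologicalSpace Y] (q : C(P, X)) (p : C(P, A)) (f : C(X, Y)) (ι : C(A, Y)),
      SecatOp.IsHomotopyPullback q p f ι → SecatOp.liftcatOp f ι = SecatOp.secatOp q) ∧
    SecatOp.IsPointedSectionalCategory.{u} SecatOp.pointedSecatOp ∧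
    (∀ {P A X Y : SecatOp.WellPointedSpace.{u}} (q : SecatOp.PointedMap P X)
      (p : SecatOp.PointedMap P A) (f : SecatOp.PointedMap X Y) (ι : SecatOp.PointedMap A Y),
      SecatOp.IsPointedHomotopyPullback q p f ι →
        SecatOp.pointedLiftcatOp f ι = SecatOp.pointedSecatOp q) :=
  ⟨SecatOp.isSectionalCategory_secatOp, fun _ _ _ _ h ↦ h.liftcatOp_eq_secatOp,
    SecatOp.isPointedSectionalCategory_pointedSecatOp,
    fun _ _ _ _ h ↦ h.pointedLiftcatOp_eq_pointedSecatOp⟩
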